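/- Let $K$ be a field endowed with the trivial absolute value and let $X$ be an integral projective scheme over $\operatorname{Spec} K$, with function field $\operatorname{Rat}(X)$. Let $X^{\mathrm{an}}$ be its Berkovich analytification: its points are the pairs $\xi=(p_\xi,|\cdot|_\xi)$ with $p_\xi\in X$ and $|\cdot|_\xi$ an absolute value on the residue field $\kappa(p_\xi)$ that is trivial on $K$; its topology is the coarsest one for which $\xi\mapsto p_\xi$ and all functions $|f|:U^{\mathrm{an}}\to\mathbb R$ ($U\subseteq X$ Zariski open, $f$ regular on $U$, $U^{\mathrm{an}}=\{\xi : p_\xi\in U\}$) are continuous. For $x\in X$ let $x^{\mathrm{an}}$ be the point given by $x$ and the trivial absolute value on $\kappa(x)$, and let $\eta_0=\eta^{\mathrm{an}}$, where $\eta$ is the generic point of $X$. Let $(D,g)$ be an adelic $\mathbb R$-Cartier divisor on $X$: $D\in \operatorname{Div}_{\mathbb R}(X)=\operatorname{Div}(X)\otimes_{\mathbb Z}\mathbb R$, where $\operatorname{Div}(X)$ is the group of Cartier divisors, and $g$ is a Green function of $D$ of $C^0$-type, that is, a continuous real function on $U^{\mathrm{an}}$ for some non-empty Zariski open $U$ (two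 such functions being identified if they coincide on $V^{\mathrm{an}}$ for some non-empty Zariski open $V$) such that, whenever $f\in\operatorname{Rat}(X)^\times\otimes_{\mathbb Z}\mathbb R$ is a local equation of $D$ on a non-empty Zariski open set $U$, the function $g+\log|f|$ extends continuously to $U^{\mathrm{an}}$. For $\xi\in X^{\mathrm{an}}$ let $r_\xi\in X$ be its reduction point, i.e. the image of the closed point under the unique $K$-morphism $\operatorname{Spec}\mathfrak o_\xi\to X$ extending $\operatorname{Spec}\kappa(p_\xi)\to X$, where $\mathfrak o_\xi=\{\alpha\in\kappa(p_\xi) : |\alpha|_\xi\le 1\}$. The height $h^{\mathrm{an}}_{(D,g)}(\xi)$ is the value at $\xi$ of the continuous extension of $g+\log|f|$ to $U^{\mathrm{an}}$, for any local equation $f$ of $D$ on a Zariski open neighbourhood $U$ of $r_\xi$; put $h_{(D,g)}(x)=h^{\mathrm{an}}_{(D,g)}(x^{\mathrm{an}})$ for $x\in X$. The essential minimum is \[\widehat{\mu}_{\mathrm{ess}}(D,g)=\sup_{Z\subsetneq X}\ \inf_{x\in X\setminus Z,\ x\text{ closed}}h_{(D,g)}(x),\] where $Z$ runs over the strict closed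 subschemes of $X$. Call $E\in\operatorname{Div}_{\mathbb R}(X)$ effective if it is a finite linear combination, with positive real coefficients, of effective Cartier divisors. Put $H^0(D)=\{s\in\operatorname{Rat}(X)^\times : (s)+D \text{ is effective}\}\cup\{0\}$. For $s\in H^0(D)\setminus\{0\}$ let $\|s\|_g$ be the supremum over $X^{\mathrm{an}}$ of the continuous extension of $e^{-g+\log|s|}$ to $X^{\mathrm{an}}$, and put $\|0\|_g=0$. Put \[\lambda_{\max}(D,g)=\sup\{t\in\mathbb R : \exists\, s\in H^0(D)\setminus\{0\},\ \|s\|_g\le e^{-t}\}\in[-\infty,+\infty],\qquad \lambda_{\max}^{\mathrm{asy}}(D,g)=\limsup_{n\to+\infty}\frac1n\lambda_{\max}(nD,ng).\] Then \[\widehat{\mu}_{\mathrm{ess}}(D,g)=g(\eta_0)\qquad\text{and}\qquad \lambda_{\max}^{\mathrm{asy}}(D,g)\le\widehat{\mu}_{\mathrm{ess}}(D,g)<+\infty .\] In particular $\lambda_{\max}^{\mathrm{asy}}(D,g)<+\infty$. -/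

import Mathlib

open AlgebraicGeometry CategoryTheory TopologicalSpace Filter
open scoped TensorProduct Topology

universe u

namespace TrivVal

/-! ### Projective schemes over a field -/

section Projective

attribute [local instance] MvPolynomial.gradedAlgebra

/-- The structure morphism `ℙⁿ_K → Spec K`, where `ℙⁿ_K = Proj K[T₀, …, Tₙ]`. -/
noncomputable def projSpaceToSpec (K : Type u) [Field K] (n : ℕ) :
    Proj (MvPolynomial.homogeneousSubmodule (Fin (n + 1)) K) ⟶ Spec (CommRingCat.of K) :=
  Proj.toSpecZero (MvPolynomial.homogeneousSubmodule (Fin (n + 1)) K) ≫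
    Spec.map (CommRingCat.ofHom
      (algebraMap K (MvPolynomial.homogeneousSubmodule (Fin (n + 1)) K 0)))

/-- A `K`-scheme is projective if it admits a closed `K`-immersion into some `ℙⁿ_K`. -/
def IsProjectiveOver {K : Type u} [Field K] {X : Scheme.{u}}
    (π : X ⟶ Spec (CommRingCat.of K)) : Prop :=
  ∃ (n : ℕ) (i : X ⟶ Proj (MvPolynomial.homogeneousSubmodule (Fin (n + 1)) K)),
    IsClosedImmersion i ∧ i ≫ projSpaceToSpec K n = π

end Projective

/-! ### The Berkovich space over the trivially valued field `K` -/

section Berkovich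

variable {K : Type u} [Field K] {X : Scheme.{u}} (π : X ⟶ Spec (CommRingCat.of K))

/-- The structure homomorphism `K → κ(p)`. -/
noncomputable def residueStructureMap (p : X) : K →+* X.residueField p :=
  (Spec.preimage (X.fromSpecResidueField p ≫ π)).hom

/-- The analytification `Xᵃⁿ` of `X` over `K` endowed with the trivial absolute value: a point is
a scheme point `p` together with an absolute value on `κ(p)` extending the trivial one of `K`. -/
@[ext]
structure Xan where
  pt : X
  abv : AbsoluteValue (X.residueField pt) ℝ
  abv_trivial : ∀ a : K, a ≠ 0 → abv (residueStructureMap π pt a) = 1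

variable {π}

/-- The subset `Uᵃⁿ` of `Xᵃⁿ`, for `U` a Zariski open subset of `X`. -/
def anOpen (π : X ⟶ Spec (CommRingCat.of K)) (U : X.Opens) : Set (Xan π) := {ξ | ξ.pt ∈ U}

/-- The value `|f|(ξ)` for a regular function `f` on `U` and `ξ ∈ Uᵃⁿ`. -/
noncomputable def Xan.absSection (ξ : Xan π) (U : X.Opens) (hξ : ξ.pt ∈ U) (f : Γ(X, U)) : ℝ :=
  ξ.abv (X.evaluation U ξ.pt hξ f)

/-- The Berkovich topology: the coarsest topology for which the map `Xᵃⁿ → X` is continuous and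
all functions `|f| : Uᵃⁿ → ℝ`, with `f` regular on a Zariski open `U`, are continuous. -/
instance : TopologicalSpace (Xan π) :=
  TopologicalSpace.generateFrom
    ({S | ∃ U : X.Opens, S = anOpen π U} ∪
     {S | ∃ (U : X.Opens) (f : Γ(X, U)) (A : Set ℝ), IsOpen A ∧
        S = {ξ | ∃ hξ : ξ.pt ∈ U, ξ.absSection U hξ f ∈ A}})

open Classical in
/-- The point `xᵃⁿ` of `Xᵃⁿ` given by `x` and the trivial absolute value on `κ(x)`. -/
noncomputable def trivialPoint (π : X ⟶ Spec (CommRingCat.of K)) (x : X) : Xan π where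
  pt := x
  abv := AbsoluteValue.trivial
  abv_trivial := by
    intro a ha
    exact AbsoluteValue.trivial_apply (by simpa using ha)

/-- The absolute value of `ξ` is non-archimedean, since it is trivial on `K`. -/
theorem Xan.abv_add_le_max (ξ : Xan π) (a b : X.residueField ξ.pt) :
    ξ.abv (a + b) ≤ max (ξ.abv a) (ξ.abv b) := by
  let _ : NormedField (X.residueField ξ.pt) := ξ.abv.toNormedField
  have hn : ∀ n : ℕ, ‖(n : X.residueField ξ.pt)‖ ≤ 1 := by
    intro n
    change ξ.abv _ ≤ 1
    by_cases h : (n : K) = 0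
    · have : (n : X.residueField ξ.pt) = 0 := by
        rw [← map_natCast (residueStructureMap π ξ.pt), h, map_zero]
      simp [this]
    · rw [← map_natCast (residueStructureMap π ξ.pt), ξ.abv_trivial _ h]
  have := IsUltrametricDist.isUltrametricDist_of_forall_norm_natCast_le_one hn
  exact IsUltrametricDist.norm_add_le_max a b

/-- The valuation ring `𝔬_ξ = {α ∈ κ(ξ) | |α|_ξ ≤ 1}`. -/
noncomputable def Xan.valRing (ξ : Xan π) : ValuationSubring (X.residueField ξ.pt) where
  carrier := {α | ξ.abv α ≤ 1}
  zero_mem' := by simp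
  one_mem' := by simp
  add_mem' := fun {a b} ha hb => (ξ.abv_add_le_max a b).trans (max_le ha hb)
  mul_mem' := fun {a b} ha hb => by
    simpa using mul_le_one₀ ha (ξ.abv.nonneg b) hb
  neg_mem' := fun {a} ha => by simpa using ha
  mem_or_inv_mem' := fun a => by
    rcases le_total (ξ.abv a) 1 with h | h
    · exact Or.inl h
    · exact Or.inr (by simpa using inv_le_one_of_one_le₀ h)

/-- `r` is the reduction point of `ξ`: the image of the closed point under a morphism
`Spec 𝔬_ξ → X` extending the canonical morphism `Spec κ(ξ) → X`. For `X` proper over `K` each `ξ`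
has exactly one reduction point. (Such a morphism is automatically a `K`-morphism, as
`𝔬_ξ → κ(ξ)` is injective.) -/
def IsReductionPoint (ξ : Xan π) (r : X) : Prop :=
  ∃ ℓ : Spec (CommRingCat.of ξ.valRing) ⟶ X,
    Spec.map (CommRingCat.ofHom (algebraMap ξ.valRing (X.residueField ξ.pt))) ≫ ℓ =
      X.fromSpecResidueField ξ.pt ∧
    ℓ (IsLocalRing.closedPoint ξ.valRing) = r

theorem continuousOn_absSection (U : X.Opens) (a : Γ(X, U)) (θ : Xan π → ℝ)
    (h : ∀ (ξ : Xan π) (hξ : ξ.pt ∈ U), θ ξ = ξ.absSection U hξ a) :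
    ContinuousOn θ (anOpen π U) := by
  rw [continuousOn_iff']
  intro A hA
  refine ⟨{ξ | ∃ hξ : ξ.pt ∈ U, ξ.absSection U hξ a ∈ A},
    TopologicalSpace.isOpen_generateFrom_of_mem (Or.inr ⟨U, a, A, hA, rfl⟩), ?_⟩
  ext ξ
  constructor
  · rintro ⟨h1, h2⟩
    exact ⟨⟨h2, by rw [← h ξ h2]; exact h1⟩, h2⟩
  · rintro ⟨⟨h1, h2⟩, h3⟩
    exact ⟨by rw [← h ξ h1] at h2; exact h2, h3⟩

end Berkovich

/-! ### `ℝ`-Cartier divisors on an integral scheme -/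

section Cartier

variable (X : Scheme.{u}) [IsIntegral X]

/-- The group `Rat(X)^×` in additive notation. -/
abbrev RatUnits : Type u := Additive (X.functionField)ˣ

/-- The subgroup `𝒪_{X,x}^×` of `Rat(X)^×`. -/
noncomputable def stalkUnits (x : X) : AddSubgroup (RatUnits X) :=
  (Units.map (algebraMap (X.presheaf.stalk x) X.functionField).toMonoidHom).toAdditive.range

/-- The stalk `Rat(X)^× / 𝒪_{X,x}^×` of the sheaf `ℳ_X^× / 𝒪_X^×` at `x`, in additive notation. -/
abbrev CartierStalk (x : X) : Type u := RatUnits X ⧸ stalkUnits X x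

/-- The class of a rational function in the stalk of `ℳ_X^× / 𝒪_X^×` at `x`. -/
noncomputable def toCartierStalk (x : X) : RatUnits X →+ CartierStalk X x :=
  QuotientAddGroup.mk' (stalkUnits X x)

/-- The group `Div(X) = H⁰(X, ℳ_X^× / 𝒪_X^×)` of Cartier divisors: families of germs that are
locally given by one rational function. -/
noncomputable def CartierDiv : AddSubgroup (∀ x : X, CartierStalk X x) where
  carrier := {D | ∀ x : X, ∃ U : X.Opens, x ∈ U ∧ ∃ f : RatUnits X,
    ∀ y ∈ U, D y = toCartierStalk X y f}
  zero_mem' := fun x => ⟨⊤, trivial, 0, fun y _ => by simp⟩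
  add_mem' := by
    intro D E hD hE x
    obtain ⟨U, hU, f, hf⟩ := hD x
    obtain ⟨V, hV, g, hg⟩ := hE x
    exact ⟨U ⊓ V, ⟨hU, hV⟩, f + g, fun y hy => by simp [hf y hy.1, hg y hy.2]⟩
  neg_mem' := by
    intro D hD x
    obtain ⟨U, hU, f, hf⟩ := hD x
    exact ⟨U, hU, -f, fun y hy => by simp [hf y hy]⟩

/-- The principal Cartier divisor of a non-zero rational function. -/
noncomputable def principalDiv : RatUnits X →+ CartierDiv X where
  toFun f := ⟨fun x => toCartierStalk X x f, fun _ => ⟨⊤, trivial, f, fun _ _ => rfl⟩⟩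
  map_zero' := by ext x; simp
  map_add' f g := by ext x; simp

/-- `Rat(X)^×_ℝ = Rat(X)^× ⊗_ℤ ℝ`. -/
abbrev RatR : Type u := ℝ ⊗[ℤ] RatUnits X

/-- `Div_ℝ(X) = Div(X) ⊗_ℤ ℝ`. -/
abbrev RDiv : Type u := ℝ ⊗[ℤ] CartierDiv X

/-- The principal `ℝ`-Cartier divisor `(φ)` of an `ℝ`-rational function `φ`. -/
noncomputable def principalRDiv : RatR X →ₗ[ℝ] RDiv X :=
  (principalDiv X).toIntLinearMap.baseChange ℝ

variable {X}

/-- The germ of an `ℝ`-Cartier divisor at `x`, in `(Rat(X)^× / 𝒪_{X,x}^×) ⊗_ℤ ℝ`. -/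
noncomputable def rdivGerm (x : X) : RDiv X →ₗ[ℝ] ℝ ⊗[ℤ] CartierStalk X x :=
  (((Pi.evalAddMonoidHom (fun x : X => CartierStalk X x) x).comp
    (CartierDiv X).subtype).toIntLinearMap).baseChange ℝ

/-- The germ at `x` of the `ℝ`-Cartier divisor of an `ℝ`-rational function. -/
noncomputable def ratRGerm (x : X) : RatR X →ₗ[ℝ] ℝ ⊗[ℤ] CartierStalk X x :=
  (toCartierStalk X x).toIntLinearMap.baseChange ℝ

/-- `f ∈ Rat(X)^×_ℝ` is a local equation of `D` on `U`: the sections of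
`(ℳ_X^× / 𝒪_X^×) ⊗ ℝ` over `U` defined by `D` and by `f` coincide, which is tested on stalks. (For
`U` Noetherian, `H⁰(U, ℳ_X^× / 𝒪_X^×) ⊗ ℝ → H⁰(U, (ℳ_X^× / 𝒪_X^×) ⊗ ℝ)` is bijective.) -/
def IsLocalEquation (D : RDiv X) (U : X.Opens) (f : RatR X) : Prop :=
  ∀ x ∈ U, rdivGerm x D = ratRGerm x f

/-- A Cartier divisor is effective if its local equations can be taken regular. -/
def IsEffectiveCartier (D : CartierDiv X) : Prop :=
  ∀ x : X, ∃ f : RatUnits X,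
    (f.toMul : X.functionField) ∈ Set.range (algebraMap (X.presheaf.stalk x) X.functionField) ∧
    (D : ∀ x : X, CartierStalk X x) x = toCartierStalk X x f

/-- `D ≥_ℝ 0`: `D` is a combination of effective Cartier divisors with positive real
coefficients. -/
def IsEffectiveR (D : RDiv X) : Prop :=
  ∃ (r : ℕ) (E : Fin r → CartierDiv X) (a : Fin r → ℝ),
    (∀ i, IsEffectiveCartier (E i)) ∧ (∀ i, 0 < a i) ∧ D = ∑ i, a i ⊗ₜ[ℤ] E i

/-- `H⁰(D) = {s ∈ Rat(X)^× | (s) + D ≥_ℝ 0} ∪ {0}`. -/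
def H0 (D : RDiv X) : Set X.functionField :=
  {s | ∃ t : (X.functionField)ˣ, (t : X.functionField) = s ∧
    IsEffectiveR (principalRDiv X (1 ⊗ₜ[ℤ] Additive.ofMul t) + D)} ∪ {0}

end Cartier

/-! ### Green functions -/

section Green

variable {K : Type u} [Field K] {X : Scheme.{u}} [IsIntegral X] {π : X ⟶ Spec (CommRingCat.of K)}

theorem nonempty_inf {U V : X.Opens} (hU : (U : Set X).Nonempty) (hV : (V : Set X).Nonempty) :
    ((U ⊓ V : X.Opens) : Set X).Nonempty :=
  nonempty_preirreducible_inter U.isOpen V.isOpen hU hV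

/-- The filter on `Xᵃⁿ` generated by the `Uᵃⁿ` with `U` a non-empty Zariski open subset. Two
functions have the same germ along it iff they coincide on a non-empty Zariski open subset. -/
def genericFilter (π : X ⟶ Spec (CommRingCat.of K)) : Filter (Xan π) where
  sets := {S | ∃ U : X.Opens, (U : Set X).Nonempty ∧ anOpen π U ⊆ S}
  univ_sets := ⟨⊤, ⟨genericPoint X, trivial⟩, Set.subset_univ _⟩
  sets_of_superset := fun ⟨U, hU, h⟩ h' => ⟨U, hU, h.trans h'⟩
  inter_sets := fun ⟨U, hU, h⟩ ⟨V, hV, h'⟩ =>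
    ⟨U ⊓ V, nonempty_inf hU hV, fun _ hx => ⟨h hx.1, h' hx.2⟩⟩

theorem mem_genericFilter {S : Set (Xan π)} :
    S ∈ genericFilter π ↔ ∃ U : X.Opens, (U : Set X).Nonempty ∧ anOpen π U ⊆ S := Iff.rfl

/-- A germ *extends to a continuous function on `Uᵃⁿ`*, namely to (the restriction to `Uᵃⁿ` of)
`θ`. -/
def IsExtension (γ : Germ (genericFilter π) ℝ) (U : X.Opens) (θ : Xan π → ℝ) : Prop :=
  ContinuousOn θ (anOpen π U) ∧ (θ : Germ (genericFilter π) ℝ) = γ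

variable (π) in
/-- The `ℝ`-vector space `Ĉ⁰(Xᵃⁿ)` of continuous functions on non-empty Zariski open subsets of
`Xᵃⁿ`, two functions being identified if they coincide on a non-empty Zariski open subset. -/
def Chat : Submodule ℝ (Germ (genericFilter π) ℝ) where
  carrier := {γ | ∃ (U : X.Opens) (θ : Xan π → ℝ), (U : Set X).Nonempty ∧ IsExtension γ U θ}
  zero_mem' := ⟨⊤, 0, ⟨genericPoint X, trivial⟩, continuousOn_const, rfl⟩
  add_mem' := by
    rintro _ _ ⟨U, θ, hU, hθ, rfl⟩ ⟨V, θ', hV, hθ', rfl⟩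
    exact ⟨U ⊓ V, θ + θ', nonempty_inf hU hV,
      (hθ.mono fun _ h => h.1).add (hθ'.mono fun _ h => h.2), rfl⟩
  smul_mem' := by
    rintro c _ ⟨U, θ, hU, hθ, rfl⟩
    exact ⟨U, c • θ, hU, hθ.const_smul c, rfl⟩

/-- The value `|f|(ξ)` of a rational function `f` regular at (the scheme point of) `ξ`;
`0` by convention if `f` is not regular there. -/
noncomputable def ratAbs (f : X.functionField) (ξ : Xan π) : ℝ :=
  open Classical in
  if h : ∃ a : X.presheaf.stalk ξ.pt, algebraMap _ X.functionField a = f then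
    ξ.abv (X.residue ξ.pt h.choose) else 0

theorem algebraMap_stalk_injective (x : X) :
    Function.Injective (algebraMap (X.presheaf.stalk x) X.functionField) := by
  have : IsFractionRing (X.presheaf.stalk x) X.functionField := inferInstance
  exact IsFractionRing.injective _ _

theorem ratAbs_algebraMap (ξ : Xan π) (a : X.presheaf.stalk ξ.pt) :
    ratAbs (algebraMap _ X.functionField a) ξ = ξ.abv (X.residue ξ.pt a) := by
  have h : ∃ b : X.presheaf.stalk ξ.pt,
      algebraMap _ X.functionField b = algebraMap _ X.functionField a := ⟨a, rfl⟩
  rw [ratAbs, dif_pos h, algebraMap_stalk_injective _ h.choose_spec]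

/-- A non-zero rational function is a nowhere vanishing regular function on some non-empty open
subset. -/
theorem exists_regular (f : (X.functionField)ˣ) :
    ∃ (U : X.Opens) (a : Γ(X, U)), (U : Set X).Nonempty ∧
      ∀ (x : X) (hx : x ∈ U), X.evaluation U x hx a ≠ 0 ∧
        algebraMap _ X.functionField (X.presheaf.germ U x hx a) = f := by
  obtain ⟨U, hU, a, ha⟩ := X.presheaf.exists_germ_eq (f : X.functionField)
  have hle : X.basicOpen a ≤ U := X.basicOpen_le a
  have hη : genericPoint X ∈ X.basicOpen a := by
    rw [Scheme.mem_basicOpen _ _ _ hU]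
    exact ha ▸ f.isUnit
  refine ⟨X.basicOpen a, X.presheaf.map (homOfLE hle).op a, ⟨_, hη⟩, fun x hx => ?_⟩
  have : Nonempty U := ⟨⟨_, hU⟩⟩
  have h1 : X.presheaf.germ (X.basicOpen a) x hx (X.presheaf.map (homOfLE hle).op a) =
      X.presheaf.germ U x (hle hx) a := X.presheaf.germ_res_apply _ _ _ _
  constructor
  · have h2 : X.evaluation (X.basicOpen a) x hx (X.presheaf.map (homOfLE hle).op a) =
        X.evaluation U x (hle hx) a := congrArg (X.residue x) h1
    rw [h2, Scheme.evaluation_ne_zero_iff_mem_basicOpen]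
    exact hx
  · rw [h1, Scheme.algebraMap_germ_eq_germToFunctionField]
    exact ha

variable (π) in
/-- The homomorphism `f ↦ log|f|` from `Rat(X)^×` to `Ĉ⁰(Xᵃⁿ)`. -/
noncomputable def logAbs : RatUnits X →+ Chat π where
  toFun f := ⟨((fun ξ => Real.log (ratAbs (f.toMul : X.functionField) ξ) : Xan π → ℝ) :
      Germ (genericFilter π) ℝ), by
    obtain ⟨U, a, hU, ha⟩ := exists_regular f.toMul
    have key : ∀ (ξ : Xan π) (hξ : ξ.pt ∈ U),
        ratAbs (f.toMul : X.functionField) ξ = ξ.absSection U hξ a := fun ξ hξ => by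
      rw [← (ha ξ.pt hξ).2, ratAbs_algebraMap]
      rfl
    refine ⟨U, _, hU, ContinuousOn.log (continuousOn_absSection U a _ key) ?_, rfl⟩
    intro ξ hξ
    rw [key ξ hξ]
    exact ξ.abv.ne_zero (ha ξ.pt hξ).1⟩
  map_zero' := by
    refine Subtype.ext (Germ.coe_eq.2 (Eventually.of_forall fun ξ => ?_))
    have : ratAbs (1 : X.functionField) ξ = 1 := by
      rw [← map_one (algebraMap (X.presheaf.stalk ξ.pt) X.functionField), ratAbs_algebraMap]
      simp
    simp [this]
  map_add' f g := by
    refine Subtype.ext (Germ.coe_eq.2 ?_)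
    obtain ⟨U, a, hU, ha⟩ := exists_regular f.toMul
    obtain ⟨V, b, hV, hb⟩ := exists_regular g.toMul
    refine ⟨U ⊓ V, nonempty_inf hU hV, fun ξ hξ => ?_⟩
    have h1 := (ha ξ.pt hξ.1).1
    have h2 := (hb ξ.pt hξ.2).1
    change Real.log _ = Real.log _ + Real.log _
    rw [toMul_add, Units.val_mul, ← (ha ξ.pt hξ.1).2, ← (hb ξ.pt hξ.2).2, ← map_mul]
    simp only [ratAbs_algebraMap]
    rw [map_mul, map_mul]
    exact Real.log_mul (ξ.abv.ne_zero h1) (ξ.abv.ne_zero h2)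

variable (π) in
/-- The `ℝ`-linear map `f ↦ log|f|` from `Rat(X)^×_ℝ` to `Ĉ⁰(Xᵃⁿ)` induced by `logAbs`. -/
noncomputable def logAbsR : RatR X →ₗ[ℝ] Chat π :=
  (logAbs π).toIntLinearMap.liftBaseChange ℝ

/-- `g` is a Green function (of `C⁰`-type) of `D`. -/
def IsGreen (D : RDiv X) (g : Chat π) : Prop :=
  ∀ (U : X.Opens) (f : RatR X), (U : Set X).Nonempty → IsLocalEquation D U f →
    ∃ θ, IsExtension ((g + logAbsR π f : Chat π) : Germ (genericFilter π) ℝ) U θ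

variable (π) in
/-- Adelic `ℝ`-Cartier divisors `(D, g)` on `X`. -/
structure AdelicRDiv where
  D : RDiv X
  g : Chat π
  isGreen : IsGreen D g

/-! ### Sup norms and `λ_max` -/

/-- The norm `‖s‖_g = sup_{ξ ∈ Xᵃⁿ} |s|_g(ξ)` of a non-zero `s`, where `|s|_g` is the extension of
`exp(-g + log|s|)` to a continuous function `θ` on `Xᵃⁿ`. For `s ∈ H⁰(D)` and `g` a Green function
of `D` there is exactly one such `θ`, so that the infimum has just one term. -/
noncomputable def supNorm (g : Chat π) (s : (X.functionField)ˣ) : EReal :=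
  ⨅ (θ : Xan π → ℝ) (_ : IsExtension
      (Germ.map Real.exp ((-g + logAbs π (Additive.ofMul s) : Chat π) :
        Germ (genericFilter π) ℝ)) ⊤ θ), ⨆ ξ : Xan π, (θ ξ : EReal)

/-- `ℱᵗ(H⁰(D)) = {s ∈ H⁰(D) | ‖s‖_g ≤ e⁻ᵗ}`. -/
def filtH0 (D : RDiv X) (g : Chat π) (t : ℝ) : Set X.functionField :=
  {s | s ∈ H0 D ∧ ∀ u : (X.functionField)ˣ, (u : X.functionField) = s →
    supNorm g u ≤ (Real.exp (-t) : EReal)}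

/-- `λ_max(D, g) = sup {t ∈ ℝ | ℱᵗ(H⁰(D)) ≠ {0}}`. -/
noncomputable def lambdaMax (D : RDiv X) (g : Chat π) : EReal :=
  ⨆ (t : ℝ) (_ : filtH0 D g t ≠ {0}), (t : EReal)

/-- `λ_max^asy(D, g) = limsup_n λ_max(nD, ng) / n`. -/
noncomputable def lambdaMaxAsy (A : AdelicRDiv π) : EReal :=
  limsup (fun n : ℕ => lambdaMax (n • A.D) (n • A.g) / (n : EReal)) atTop

/-! ### Heights and the essential minimum -/

/-- `c` is the height of `ξ`: the value at `ξ` of the continuous extension of `g + log|f|` to `Uᵃⁿ`,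
for a local equation `f` of `D` on a Zariski open neighbourhood `U` of the reduction point. -/
def IsHeight (A : AdelicRDiv π) (ξ : Xan π) (c : ℝ) : Prop :=
  ∃ (r : X) (U : X.Opens) (f : RatR X) (θ : Xan π → ℝ), IsReductionPoint ξ r ∧ r ∈ U ∧
    IsLocalEquation A.D U f ∧
    IsExtension ((A.g + logAbsR π f : Chat π) : Germ (genericFilter π) ℝ) U θ ∧ c = θ ξ

open Classical in
/-- The height function `h^an_{(D,g)}` on `Xᵃⁿ`. For projective `X` the number `c` exists and does
not depend on the choice of `U`, `f` and `θ`. -/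
noncomputable def heightAn (A : AdelicRDiv π) (ξ : Xan π) : ℝ :=
  if h : ∃ c, IsHeight A ξ c then h.choose else 0

/-- The height `h_{(D,g)}(x) = h^an_{(D,g)}(xᵃⁿ)` of a point of `X`. -/
noncomputable def height (A : AdelicRDiv π) (x : X) : ℝ :=
  heightAn A (trivialPoint π x)

/-- The essential minimum: the supremum over all strict closed subsets `Z` of `X` (as `X` is reduced,
the underlying sets of the strict closed subschemes) of the infimum of the heights of the closed points outside `Z`. -/
noncomputable def essMin (A : AdelicRDiv π) : EReal :=
  ⨆ (Z : Set X) (_ : IsClosed Z) (_ : Z ≠ Set.univ),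
    ⨅ (x : X) (_ : x ∉ Z) (_ : IsClosed ({x} : Set X)), (height A x : EReal)

variable (π) in
/-- The point `η₀` of `Xᵃⁿ`: the generic point of `X` with the trivial absolute value. -/
noncomputable def eta0 : Xan π := trivialPoint π (genericPoint X)

/-- The value `g(η₀)`; it makes sense because `η₀` lies in `Uᵃⁿ` for each non-empty Zariski
open `U`. -/
noncomputable def evalEta0 (g : Chat π) : ℝ :=
  (g : Germ (genericFilter π) ℝ).liftOn (fun θ => θ (eta0 π)) (by
    rintro θ θ' ⟨U, hU, h⟩
    have hη : genericPoint X ∈ U :=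
      ((genericPoint_spec X).mem_open_set_iff U.isOpen).2 (by simpa using hU)
    exact h hη)

end Green

end TrivVal

/-! The point is that log|f| vanishes at η₀ for every f in Rat(X)^× ⊗ ℝ, since η₀ carries a trivial
absolute value and f is invertible at η. Near η the height is x ↦ θ(xᵃⁿ), where θ is the continuous
extension of g + log|f| for a local equation f. The map x ↦ xᵃⁿ is continuous at η, so heights tend
to θ(η₀) = g(η₀) along Zariski neighbourhoods of η (`tendsto_height`). Closed points meet every
non-empty open set, because X is Jacobson, so the essential minimum equals this limit (`essMin_eq`).
Likewise |s|_g(η₀) = exp(-g(η₀)) for every non-zero s. Hence ‖s‖_g ≥ exp(-g(η₀)) and λ_max(nD, ng) ≤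
n g(η₀) (`lambdaMax_le`).

The difficulty is that the height be well defined: g is only a generic germ, so the value at xᵃⁿ of
its extension must be determined by values over η. For this, xᵃⁿ is written as a limit of points
over η. A real absolute value |·| on Rat(X) that is ≤ 1 on 𝒪_{X,x} and < 1 on its maximal ideal has
powers |·|ⁿ that converge to xᵃⁿ. Such a value exists because 𝒪_{X,x} is a Noetherian local domain;
when it is not a field, the value is found by blowing up the maximal ideal and localizing at a prime
of height at most one (`IsLocalRing.exists_absoluteValue_dominating`). -/

/-! ### Real absolute values dominating a Noetherian local domain -/

section DominatingAbsoluteValue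

open IsLocalRing

/-- By `h`, t lies in every non-zero prime of C, so C has a smallest non-zero prime, the radical of
(t). Localizing there gives an overring of rank one, whose value group embeds in the positive reals.
-/
theorem ValuationSubring.exists_absoluteValue_of_archimedean {L : Type*} [Field L]
    (C : ValuationSubring L) {t : L} (ht : t ≠ 0) (ht' : t⁻¹ ∉ C)
    (h : ∀ z : L, ∃ n : ℕ, t ^ n * z ∈ C) :
    ∃ abv : AbsoluteValue L ℝ, (∀ z ∈ C, abv z ≤ 1) ∧ abv t < 1 := by
  have htC : t ∈ C := (C.mem_or_inv_mem t).resolve_right ht'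
  have hmul : ∀ {a b : L}, (∀ k : ℕ, t * a ^ k ∈ C) → (∀ k : ℕ, t * b ^ k ∈ C) →
      ∀ k : ℕ, t * (a * b) ^ k ∈ C := by
    intro a b ha hb k
    -- Only one factor t is available for a product of two elements, so the square is tested
    -- instead, using exponent 2k for each factor.
    have h2 : (t * (a * b) ^ k) ^ 2 ∈ C := by
      have := C.mul_mem _ _ (ha (2 * k)) (hb (2 * k))
      convert this using 1
      ring
    rw [← C.valuation_le_one_iff] at h2 ⊢
    rw [map_pow] at h2
    exact (pow_le_one_iff two_ne_zero).1 h2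
  have hadd : ∀ {a b : L}, (∀ k : ℕ, t * a ^ k ∈ C) → (∀ k : ℕ, t * b ^ k ∈ C) →
      ∀ k : ℕ, t * (a + b) ^ k ∈ C := by
    intro a b ha hb k
    simp only [← C.valuation_le_one_iff, map_mul, map_pow] at ha hb ⊢
    rcases le_max_iff.1 (C.valuation.map_add a b) with h1 | h1
    · exact (by gcongr : _ ≤ C.valuation t * C.valuation a ^ k).trans (ha k)
    · exact (by gcongr : _ ≤ C.valuation t * C.valuation b ^ k).trans (hb k)
  -- The rank one overring, described without primes: the elements all of whose powers have poles
  -- bounded by t.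
  let D : ValuationSubring L :=
    { carrier := {a | ∀ k : ℕ, t * a ^ k ∈ C}
      zero_mem' := fun k => C.mul_mem _ _ htC (pow_mem C.zero_mem k)
      one_mem' := fun k => C.mul_mem _ _ htC (pow_mem C.one_mem k)
      add_mem' := hadd
      mul_mem' := hmul
      neg_mem' := by
        intro a ha
        rw [← neg_one_mul]
        exact hmul (fun k => C.mul_mem _ _ htC (pow_mem (C.neg_mem _ C.one_mem) k)) ha
      mem_or_inv_mem' := fun a => (C.mem_or_inv_mem a).imp
        (fun ha k => C.mul_mem _ _ htC (pow_mem ha k))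
        (fun ha k => C.mul_mem _ _ htC (pow_mem ha k)) }
  have hCD : ∀ {a}, a ∈ C → a ∈ D := fun ha k => C.mul_mem _ _ htC (pow_mem ha k)
  have htD : t⁻¹ ∉ D := fun hk => ht' (by simpa [pow_two, ht] using hk 2)
  have htD1 : D.valuation t < 1 := by
    have := (D.valuation_le_one_iff t⁻¹).not.2 htD
    rw [map_inv₀, not_le, one_lt_inv_iff₀] at this
    exact this.2
  have htpos : 0 < D.valuation t := zero_lt_iff.2 ((map_ne_zero _).2 ht)
  -- If b ∉ D then some t * b ^ k ∉ C, so v(t) * v(b)^k ≥ 1. Its n-th power, compared with v(t^n *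
  -- a) ≤ 1, gives v(a) ≤ v(b)^(kn).
  have : MulArchimedean D.ValueGroup := by
    refine ⟨fun x y hy => ?_⟩
    obtain ⟨a, rfl⟩ := D.valuation_surjective x
    obtain ⟨b, rfl⟩ := D.valuation_surjective y
    obtain ⟨n, hn⟩ := h a
    have hb : b ∉ D := by rw [← D.valuation_le_one_iff]; exact hy.not_ge
    obtain ⟨k, hk⟩ : ∃ k : ℕ, t * b ^ k ∉ C := by
      by_contra! hcon
      exact hb hcon
    have hk' : (t * b ^ k)⁻¹ ∈ D := hCD ((C.mem_or_inv_mem _).resolve_left hk)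
    have hb0 : b ≠ 0 := by rintro rfl; exact hb D.zero_mem
    have hbk : 0 < D.valuation (t * b ^ k) := zero_lt_iff.2 ((map_ne_zero _).2 (by positivity))
    rw [← D.valuation_le_one_iff, map_inv₀, inv_le_one₀ hbk, map_mul, map_pow] at hk'
    have hn' := (D.valuation_le_one_iff _).2 (hCD hn)
    rw [map_mul, map_pow] at hn'
    refine ⟨k * n, ?_⟩
    have h3 : 1 ≤ D.valuation t ^ n * D.valuation b ^ (k * n) := by
      rw [pow_mul, ← mul_pow]
      exact one_le_pow₀ hk'
    exact le_of_mul_le_mul_left (hn'.trans h3) (pow_pos htpos n)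
  have : D.valuation.IsNontrivial := ⟨⟨t, htpos.ne', htD1.ne⟩⟩
  have : MulArchimedean (MonoidWithZeroHom.ValueGroup₀ (.ofClass D.valuation)) :=
    MulArchimedean.comap MonoidWithZeroHom.ValueGroup₀.embedding.toMonoidHom
      MonoidWithZeroHom.ValueGroup₀.embedding_strictMono
  obtain ⟨hr⟩ := Valuation.nonempty_rankOne_iff_mulArchimedean.2 this
  let ν : L → NNReal := fun z => Valuation.RankOne.hom D.valuation (D.valuation.restrict z)
  have hνle : ∀ {z}, D.valuation z ≤ 1 → ν z ≤ 1 := fun {z} hz => by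
    have : D.valuation.restrict z ≤ D.valuation.restrict 1 :=
      (Valuation.restrict_le_iff _).2 (by simpa using hz)
    have := (Valuation.RankOne.strictMono D.valuation).monotone this
    simpa [ν] using this
  refine ⟨{ toFun := fun z => ν z
            map_mul' := fun a b => by simp [ν]
            nonneg' := fun a => NNReal.coe_nonneg _
            eq_zero' := fun a => by simp [ν]
            add_le' := fun a b => ?_ }, fun z hz => ?_, ?_⟩
  · rw [← NNReal.coe_add, NNReal.coe_le_coe]
    refine le_trans ?_ (max_le_add_of_nonneg (zero_le (a := ν a)) (zero_le (a := ν b)))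
    have := (Valuation.RankOne.strictMono D.valuation).monotone
      (D.valuation.restrict.map_add a b)
    rwa [(Valuation.RankOne.strictMono D.valuation).monotone.map_max] at this
  · exact hνle ((D.valuation_le_one_iff _).2 (hCD hz))
  · have : D.valuation.restrict t < D.valuation.restrict 1 :=
      (Valuation.restrict_lt_iff _).2 (by simpa using htD1)
    have := Valuation.RankOne.strictMono D.valuation this
    simp only [map_one] at this
    exact_mod_cast this

theorem Ideal.mem_minimalPrimes_span_singleton_of_height_le_one {A : Type*} [CommRing A]
    [IsDomain A] [IsNoetherianRing A] {P : Ideal A} [P.IsPrime] (hP : P.height ≤ 1) {z : A} (hz : z ≠ 0)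
    (hzP : z ∈ P) : P ∈ (Ideal.span {z}).minimalPrimes := by
  refine ⟨⟨inferInstance, by simpa [Ideal.span_le] using hzP⟩, ?_⟩
  rintro q ⟨hq, hzq⟩ hqP
  by_contra hcon
  have hlt : q < P := lt_of_le_not_ge hqP hcon
  have h1 := Ideal.height_strict_mono_of_isPrime_of_isPrime hlt
  have h0 : q.height = 0 := Order.lt_one_iff.1 (h1.trans_le hP)
  rw [Ideal.height_eq_zero_iff_eq_bot] at h0
  subst h0
  exact hz (by simpa using hzq)

/-- The local ring at P has dimension at most one, so a non-zero z in P generates an ideal with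
radical the maximal ideal, which contains a power of t. The element u clears denominators. This is
what makes every fraction a bounded power of t away from the localization. -/
theorem Ideal.exists_mul_pow_mem_span_singleton {A : Type*} [CommRing A]
    [IsDomain A] [IsNoetherianRing A] {P : Ideal A} [P.IsPrime] (hP : P.height ≤ 1) {z t : A} (hz : z ≠ 0)
    (htP : t ∈ P) : ∃ (n : ℕ) (u : A), u ∉ P ∧ u * t ^ n ∈ Ideal.span {z} := by
  by_cases hzP : z ∈ P
  · have hmin := Ideal.mem_minimalPrimes_span_singleton_of_height_le_one hP hz hzP
    have hr := IsLocalization.AtPrime.radical_map_of_mem_minimalPrimes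
      (A := Localization.AtPrime P) P _ hmin
    have : algebraMap A (Localization.AtPrime P) t ∈
      (Ideal.map (algebraMap A (Localization.AtPrime P)) (Ideal.span {z})).radical := by
      rw [hr]
      exact Ideal.mem_map_of_mem _ htP
    obtain ⟨n, hn⟩ := this
    rw [← map_pow, IsLocalization.algebraMap_mem_map_algebraMap_iff P.primeCompl] at hn
    obtain ⟨u, hu, hun⟩ := hn
    exact ⟨n, u, hu, hun⟩
  · exact ⟨0, z, hzP, by simp⟩

theorem LocalSubring.valuation_eq_one_of_ofPrime_le {L : Type*} [Field L] {A : Subring L} {P : Ideal A}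
    [P.IsPrime] {C : ValuationSubring L} (h : LocalSubring.ofPrime A P ≤ C.toLocalSubring)
    {u : A} (hu : u ∉ P) : C.valuation u = 1 := by
  have h1 : IsUnit (algebraMap A (LocalSubring.ofPrime A P).toSubring u) :=
    IsLocalization.map_units (M := P.primeCompl) _ ⟨u, hu⟩
  have h2 := h1.map (Subring.inclusion h.1)
  exact (C.valuation_eq_one_iff _).1 h2

theorem LocalSubring.valuation_lt_one_of_ofPrime_le {L : Type*} [Field L] {A : Subring L} {P : Ideal A}
    [P.IsPrime] {C : ValuationSubring L} (h : LocalSubring.ofPrime A P ≤ C.toLocalSubring)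
    {x : A} (hx : x ∈ P) : C.valuation x < 1 := by
  have h1 : ¬ IsUnit (algebraMap A (LocalSubring.ofPrime A P).toSubring x) := by
    rw [IsLocalization.AtPrime.isUnit_to_map_iff _ P]
    exact fun h => h hx
  have := h.2
  have h2 : ¬ IsUnit (Subring.inclusion h.1 (algebraMap A (LocalSubring.ofPrime A P).toSubring x)) :=
    fun h => h1 (isUnit_of_map_unit _ _ h)
  exact (C.valuation_lt_one_iff _).1 ((mem_maximalIdeal _).2 h2)

/-- On the chart R[𝔪/t] of the blow-up of 𝔪, the ideal 𝔪 becomes generated by t. A prime minimal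
over t has height at most one by Krull, and C dominates the local ring there. Divisibility of 𝔪 by t
in C, rather than mere domination of R, is required: it survives the later passage to a coarser rank
one valuation. -/
theorem IsLocalRing.exists_valuationSubring_archimedean (R L : Type*) [CommRing R] [IsDomain R]
    [IsNoetherianRing R] [IsLocalRing R] [Field L] [Algebra R L] [IsFractionRing R L]
    (hR : maximalIdeal R ≠ ⊥) :
    ∃ (C : ValuationSubring L) (t : L), t ≠ 0 ∧ t⁻¹ ∉ C ∧ (∀ z : L, ∃ n : ℕ, t ^ n * z ∈ C) ∧
      (∀ r : R, algebraMap R L r ∈ C) ∧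
      ∀ r ∈ maximalIdeal R, ∃ c ∈ C, algebraMap R L r = t * c := by
  classical
  have hinj : Function.Injective (algebraMap R L) := IsFractionRing.injective R L
  -- The auxiliary valuation ring B selects the chart: t is a generator of 𝔪 of largest B-value, so
  -- the chart lies in B, and t, of value < 1, is not a unit there.
  obtain ⟨B, hB, hB'⟩ := (LocalSubring.range (algebraMap R L)).exists_le_valuationSubring
  have hRB : ∀ r : R, algebraMap R L r ∈ B := fun r => hB ⟨r, rfl⟩
  have hmB : ∀ r ∈ maximalIdeal R, B.valuation (algebraMap R L r) < 1 := by
    intro r hr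
    refine (B.valuation_lt_one_iff ⟨_, hRB r⟩).1 ((mem_maximalIdeal _).2 fun hu => ?_)
    have h1 : IsUnit ((algebraMap R L).rangeRestrict r) :=
      hB'.1 ((algebraMap R L).rangeRestrict r) hu
    have : IsUnit r := by
      obtain ⟨⟨_, s, rfl⟩, hs⟩ := isUnit_iff_exists_inv.1 h1
      refine isUnit_iff_exists_inv.2 ⟨s, hinj ?_⟩
      simpa using congrArg Subtype.val hs
    exact hr this
  obtain ⟨s, hs⟩ : (maximalIdeal R).FG := IsNoetherian.noetherian _
  have hsm : ∀ a ∈ s, a ∈ maximalIdeal R := fun a ha => hs ▸ Ideal.subset_span ha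
  have hsne : s.Nonempty := by
    rw [Finset.nonempty_iff_ne_empty]
    rintro rfl
    exact hR (by simpa using hs.symm)
  obtain ⟨t, hts, htmax⟩ := s.exists_max_image (fun a => B.valuation (algebraMap R L a)) hsne
  have ht0 : algebraMap R L t ≠ 0 := by
    intro h0
    refine hR (hs.symm.trans (Ideal.span_eq_bot.2 fun a ha => hinj ?_))
    have := htmax a ha
    rw [h0, map_zero] at this
    rw [map_zero]
    exact (map_eq_zero _).1 (le_zero_iff.1 this)
  let A := Algebra.adjoin R ((s.image fun a => algebraMap R L a / algebraMap R L t : Finset L) : Set L)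
  have hAB : ∀ x ∈ A, x ∈ B := by
    intro x hx
    induction hx using Algebra.adjoin_induction with
    | mem x hx =>
      obtain ⟨a, ha, rfl⟩ := Finset.mem_image.1 (Finset.mem_coe.1 hx)
      rw [← B.valuation_le_one_iff, map_div₀]
      exact div_le_one_of_le₀ (htmax a ha) zero_le
    | algebraMap r => exact hRB r
    | add x y _ _ hx hy => exact B.add_mem _ _ hx hy
    | mul x y _ _ hx hy => exact B.mul_mem _ _ hx hy
  have hfg : Algebra.FiniteType R A :=
    A.fg_iff_finiteType.1 ⟨_, rfl⟩
  have hnoeth : IsNoetherianRing A.toSubring := Algebra.FiniteType.isNoetherianRing R A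
  let ι : A.toSubring →+* B := Subring.inclusion (fun x hx => hAB x hx : A.toSubring ≤ B.toSubring)
  let τ : A.toSubring := ⟨algebraMap R L t, A.algebraMap_mem t⟩
  obtain ⟨P, hPmin, -⟩ := Ideal.exists_minimalPrimes_le (I := Ideal.span {τ})
    (J := (maximalIdeal B).comap ι) (by
      rw [Ideal.span_singleton_le_iff_mem, Ideal.mem_comap, B.valuation_lt_one_iff]
      exact hmB t (hsm t hts))
  have hPp : P.IsPrime := hPmin.1.1
  have hP1 := Ideal.height_le_one_of_isPrincipal_of_mem_minimalPrimes _ P hPmin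
  have hτP : τ ∈ P := hPmin.1.2 (Ideal.mem_span_singleton_self τ)
  obtain ⟨C, hC⟩ := (LocalSubring.ofPrime A.toSubring P).exists_le_valuationSubring
  have hAC : ∀ x ∈ A, x ∈ C := fun x hx => hC.1 (LocalSubring.le_ofPrime _ _ hx)
  have hRC : ∀ r : R, algebraMap R L r ∈ C := fun r => hAC _ (A.algebraMap_mem r)
  have ht1 : C.valuation (algebraMap R L t) < 1 :=
    LocalSubring.valuation_lt_one_of_ofPrime_le hC hτP
  refine ⟨C, algebraMap R L t, ht0, ?_, ?_, hRC, ?_⟩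
  · rw [← C.valuation_le_one_iff, map_inv₀, not_le]
    exact (one_lt_inv₀ (zero_lt_iff.2 ((map_ne_zero _).2 ht0))).2 ht1
  · intro z
    obtain ⟨a, b, hb, rfl⟩ := IsFractionRing.div_surjective (A := R) z
    have hb0 : algebraMap R L b ≠ 0 :=
      (map_ne_zero_iff _ hinj).2 (nonZeroDivisors.ne_zero hb)
    -- Only the denominator b matters. From w * b = u * t^n with u a unit of C, the quotient t^n / b
    -- has the same value as w.
    obtain ⟨n, u, hu, hmem⟩ := Ideal.exists_mul_pow_mem_span_singleton hP1
      (z := (⟨algebraMap R L b, A.algebraMap_mem b⟩ : A.toSubring)) (t := τ)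
      (fun h => hb0 (congrArg Subtype.val h)) hτP
    obtain ⟨w, hw⟩ := Ideal.mem_span_singleton'.1 hmem
    have hw' : (w : L) * algebraMap R L b = u * algebraMap R L t ^ n := congrArg Subtype.val hw
    have hu1 := LocalSubring.valuation_eq_one_of_ofPrime_le hC hu
    refine ⟨n, ?_⟩
    rw [← mul_div_assoc, mul_comm, mul_div_assoc]
    refine C.mul_mem _ _ (hRC a) ?_
    rw [← C.valuation_le_one_iff]
    calc C.valuation (algebraMap R L t ^ n / algebraMap R L b)
        = C.valuation u * C.valuation (algebraMap R L t ^ n / algebraMap R L b) := by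
          rw [hu1, one_mul]
      _ = C.valuation w := by
          rw [← map_mul, ← mul_div_assoc, ← hw', mul_div_cancel_right₀ _ hb0]
      _ ≤ 1 := (C.valuation_le_one_iff _).2 (hAC _ w.2)
  · intro r hr
    refine ⟨algebraMap R L r / algebraMap R L t, ?_, by rw [mul_div_cancel₀ _ ht0]⟩
    rw [← hs] at hr
    induction hr using Submodule.span_induction with
    | mem a ha =>
      exact hAC _ (Algebra.subset_adjoin (Finset.mem_coe.2 (Finset.mem_image_of_mem _ ha)))
    | zero => simp [C.zero_mem]
    | add x y _ _ hx hy =>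
      rw [map_add, add_div]
      exact C.add_mem _ _ hx hy
    | smul c x _ hx =>
      rw [smul_eq_mul, map_mul, mul_div_assoc]
      exact C.mul_mem _ _ (hRC c) hx

/-- A Noetherian local domain that is not a field is dominated by a rank one valuation. -/
theorem IsLocalRing.exists_absoluteValue_dominating (R L : Type*) [CommRing R] [IsDomain R]
    [IsNoetherianRing R] [IsLocalRing R] [Field L] [Algebra R L] [IsFractionRing R L]
    (hR : maximalIdeal R ≠ ⊥) :
    ∃ abv : AbsoluteValue L ℝ, (∀ r : R, abv (algebraMap R L r) ≤ 1) ∧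
      ∀ r ∈ maximalIdeal R, abv (algebraMap R L r) < 1 := by
  obtain ⟨C, t, ht, ht', harch, hRC, hm⟩ := exists_valuationSubring_archimedean R L hR
  obtain ⟨abv, h1, h2⟩ := C.exists_absoluteValue_of_archimedean ht ht' harch
  refine ⟨abv, fun r => h1 _ (hRC r), fun r hr => ?_⟩
  obtain ⟨c, hc, hrc⟩ := hm r hr
  rw [hrc, map_mul]
  exact mul_lt_one_of_nonneg_of_lt_one_left (abv.nonneg _) h2 (h1 c hc)

end DominatingAbsoluteValue

/-! ### Projective schemes over a field are locally of finite type -/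

namespace TrivVal

attribute [local instance] MvPolynomial.gradedAlgebra in
theorem locallyOfFiniteType_projSpaceToSpec (K : Type u) [Field K] (n : ℕ) :
    LocallyOfFiniteType (projSpaceToSpec K n) := by
  let 𝒜 := MvPolynomial.homogeneousSubmodule (Fin (n + 1)) K
  have h0 : IsScalarTower K (𝒜 0) (MvPolynomial (Fin (n + 1)) K) :=
    IsScalarTower.of_algebraMap_eq (R := K) (S := 𝒜 0) (A := MvPolynomial (Fin (n + 1)) K) fun _ => rfl
  have h1 : Algebra.FiniteType (𝒜 0) (MvPolynomial (Fin (n + 1)) K) :=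
    Algebra.FiniteType.of_restrictScalars_finiteType K (𝒜 0) (MvPolynomial (Fin (n + 1)) K)
  have h2 : Function.Surjective (algebraMap K (𝒜 0)) := by
    rintro ⟨p, hp⟩
    have hp' : p.IsHomogeneous 0 := hp
    refine ⟨p.coeff 0, Subtype.ext ?_⟩
    have := MvPolynomial.totalDegree_eq_zero_iff_eq_C.1
      ((MvPolynomial.totalDegree_zero_iff_isHomogeneous _).2 hp')
    exact this.symm
  have h3 : LocallyOfFiniteType (Spec.map (CommRingCat.ofHom (algebraMap K (𝒜 0)))) := by
    rw [HasRingHomProperty.Spec_iff (P := @LocallyOfFiniteType)]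
    exact RingHom.FiniteType.of_surjective _ h2
  unfold projSpaceToSpec
  infer_instance

theorem IsProjectiveOver.locallyOfFiniteType {K : Type u} [Field K] {X : Scheme.{u}}
    {π : X ⟶ Spec (CommRingCat.of K)} (h : IsProjectiveOver π) : LocallyOfFiniteType π := by
  obtain ⟨n, i, hi, rfl⟩ := h
  have := locallyOfFiniteType_projSpaceToSpec K n
  infer_instance

/-! ### Points of the analytification and their reductions -/

section Points

variable {K : Type u} [Field K] {X : Scheme.{u}} {π : X ⟶ Spec (CommRingCat.of K)}

theorem isOpen_anOpen (U : X.Opens) : IsOpen (anOpen π U) :=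
  TopologicalSpace.isOpen_generateFrom_of_mem (Or.inl ⟨U, rfl⟩)

/-- Constants act on `κ(p)` through the global sections of `X`. -/
theorem residueStructureMap_eq (p : X) (a : K) :
    residueStructureMap π p a =
      X.evaluation ⊤ p trivial (π.appTop ((Scheme.ΓSpecIso (CommRingCat.of K)).inv a)) := by
  have h : Spec.preimage (X.fromSpecResidueField p ≫ π) =
      (Scheme.ΓSpecIso (CommRingCat.of K)).inv ≫ π.appTop ≫ X.evaluation ⊤ p trivial := by
    apply Spec.map_injective
    rw [Spec.map_preimage]
    have h1 : π = X.toSpecΓ ≫ Spec.map ((Scheme.ΓSpecIso (CommRingCat.of K)).inv ≫ π.appTop) := by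
      rw [Spec.map_comp, ← Scheme.toSpecΓ_naturality_assoc]
      simp
    rw [Scheme.fromSpecResidueField, Category.assoc]
    conv_lhs => rw [h1]
    rw [Scheme.fromSpecStalk_toSpecΓ_assoc]
    simp only [← Spec.map_comp, Category.assoc, Scheme.evaluation]
  rw [residueStructureMap, h]
  rfl

/-- The point of `Xᵃⁿ` whose absolute value is the `(n + 1)`-st power of that of `ξ`. -/
noncomputable def Xan.powSucc (ξ : Xan π) (n : ℕ) : Xan π where
  pt := ξ.pt
  abv :=
    { toFun := fun a => ξ.abv a ^ (n + 1)
      map_mul' := fun a b => by rw [map_mul, mul_pow]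
      nonneg' := fun a => pow_nonneg (ξ.abv.nonneg a) _
      eq_zero' := fun a => by simp
      -- The triangle inequality survives taking powers because the absolute value is ultrametric.
      add_le' := fun a b => by
        have ha := pow_nonneg (ξ.abv.nonneg a) (n + 1)
        have hb := pow_nonneg (ξ.abv.nonneg b) (n + 1)
        rcases le_max_iff.1 (ξ.abv_add_le_max a b) with h | h
        · have := pow_le_pow_left₀ (ξ.abv.nonneg _) h (n + 1)
          linarith
        · have := pow_le_pow_left₀ (ξ.abv.nonneg _) h (n + 1)
          linarith }
  abv_trivial := fun a ha => by
    change ξ.abv _ ^ (n + 1) = 1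
    rw [ξ.abv_trivial a ha, one_pow]

theorem trivialPoint_abv_apply (x : X) {a : X.residueField (trivialPoint π x).pt} (ha : a ≠ 0) :
    (trivialPoint π x).abv a = 1 := by
  have h : NoZeroDivisors (X.residueField (trivialPoint π x).pt) :=
    inferInstanceAs (NoZeroDivisors (X.residueField x))
  exact if_neg ha

theorem absSection_trivialPoint_of_ne_zero {x : X} {U : X.Opens} (hx : x ∈ U) {f : Γ(X, U)}
    (h : X.evaluation U x hx f ≠ 0) : (trivialPoint π x).absSection U hx f = 1 :=
  trivialPoint_abv_apply x h

theorem absSection_trivialPoint_of_eq_zero {x : X} {U : X.Opens} (hx : x ∈ U) {f : Γ(X, U)}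
    (h : X.evaluation U x hx f = 0) : (trivialPoint π x).absSection U hx f = 0 :=
  (congrArg (trivialPoint π x).abv h).trans (map_zero _)

/-- For a trivial absolute value the valuation ring is the whole residue field, so the canonical
morphism from its spectrum already is the required extension. -/
theorem isReductionPoint_pt {ξ : Xan π} (hξ : ∀ a, a ≠ 0 → ξ.abv a = 1) :
    IsReductionPoint ξ ξ.pt := by
  have hle : ∀ a : X.residueField ξ.pt, a ∈ ξ.valRing := fun a => by
    change ξ.abv a ≤ (1 : ℝ)
    by_cases ha : a = 0
    · simp [ha]
    · exact (hξ a ha).le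
  let φ : X.residueField ξ.pt →+* ξ.valRing := (RingHom.id _).codRestrict ξ.valRing hle
  have hφ : Spec.map (CommRingCat.ofHom (algebraMap ξ.valRing (X.residueField ξ.pt))) ≫
      Spec.map (CommRingCat.ofHom φ) = 𝟙 _ := by
    rw [← Spec.map_comp, ← CommRingCat.ofHom_comp]
    exact Spec.map_id _
  refine ⟨Spec.map (CommRingCat.ofHom φ) ≫ X.fromSpecResidueField ξ.pt, ?_, ?_⟩
  · rw [← Category.assoc, hφ]
    exact Category.id_comp _
  · exact (Scheme.Hom.comp_apply (Spec.map (CommRingCat.ofHom φ)) (X.fromSpecResidueField ξ.pt)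
      (IsLocalRing.closedPoint ξ.valRing)).trans (Scheme.fromSpecResidueField_apply _ _)

theorem IsReductionPoint.eq_pt {ξ : Xan π} (hξ : ∀ a, a ≠ 0 → ξ.abv a = 1) {r : X}
    (h : IsReductionPoint ξ r) : r = ξ.pt := by
  obtain ⟨ℓ, h1, rfl⟩ := h
  have hloc : IsLocalHom (algebraMap ξ.valRing (X.residueField ξ.pt)) := by
    refine ⟨fun a ha => ?_⟩
    have ha0 : (a : X.residueField ξ.pt) ≠ 0 := ha.ne_zero
    refine isUnit_iff_exists_inv.2
      ⟨⟨(a : X.residueField ξ.pt)⁻¹, ?_⟩, Subtype.ext (mul_inv_cancel₀ ha0)⟩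
    exact (hξ _ (inv_ne_zero ha0)).le
  have h2 := congrArg (fun m => m (IsLocalRing.closedPoint (X.residueField ξ.pt))) h1
  have h3 : Spec.map (CommRingCat.ofHom (algebraMap ξ.valRing (X.residueField ξ.pt)))
      (IsLocalRing.closedPoint (X.residueField ξ.pt)) =
      IsLocalRing.closedPoint ξ.valRing := IsLocalRing.comap_closedPoint _
  have h4 := Scheme.fromSpecResidueField_apply ξ.pt
    (IsLocalRing.closedPoint (X.residueField ξ.pt))
  rw [← h3]
  exact h2.trans h4

end Points

/-! ### Approximating trivially valued points from the generic point -/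

section Generic

variable {K : Type u} [Field K] {X : Scheme.{u}} [IsIntegral X] {π : X ⟶ Spec (CommRingCat.of K)}

theorem genericPoint_mem_iff {U : X.Opens} : genericPoint X ∈ U ↔ (U : Set X).Nonempty :=
  ((genericPoint_spec X).mem_open_set_iff U.isOpen).trans (by simp)

theorem genericPoint_mem_of_mem {U : X.Opens} {x : X} (hx : x ∈ U) : genericPoint X ∈ U :=
  genericPoint_mem_iff.2 ⟨x, hx⟩

variable (X) in
/-- The function field is the residue field of the generic point. -/
noncomputable def functionFieldEquiv : X.functionField ≃+* X.residueField (genericPoint X) :=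
  RingEquiv.ofBijective (X.residue (genericPoint X)).hom
    ⟨(X.residue (genericPoint X)).hom.injective, X.residue_surjective _⟩

theorem functionFieldEquiv_germ {U : X.Opens} {x : X} (hx : x ∈ U) (f : Γ(X, U)) :
    functionFieldEquiv X (algebraMap (X.presheaf.stalk x) X.functionField (X.presheaf.germ U x hx f)) =
      X.evaluation U (genericPoint X) (genericPoint_mem_of_mem hx) f := by
  have : Nonempty U := ⟨⟨x, hx⟩⟩
  rw [Scheme.algebraMap_germ_eq_germToFunctionField]
  rfl

/-- An absolute value of the function field dominating a local ring of `X` defines a sequence in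
`Xᵃⁿ` over the generic point that converges to a point with trivial absolute value. -/
theorem exists_tendsto_trivialPoint_of_absoluteValue (x : X) (abv : AbsoluteValue X.functionField ℝ)
    (h1 : ∀ a : X.presheaf.stalk x, abv (algebraMap _ X.functionField a) ≤ 1)
    (h2 : ∀ a ∈ IsLocalRing.maximalIdeal (X.presheaf.stalk x),
      abv (algebraMap _ X.functionField a) < 1) :
    ∃ s : ℕ → Xan π, (∀ n, (s n).pt = genericPoint X) ∧
      Tendsto s atTop (𝓝 (trivialPoint π x)) := by
  have hunit : ∀ a : X.presheaf.stalk x, IsUnit a → abv (algebraMap _ X.functionField a) = 1 := by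
    intro a ha
    obtain ⟨b, hb⟩ := isUnit_iff_exists_inv.1 ha
    refine le_antisymm (h1 a) ?_
    have := congrArg (fun c => abv (algebraMap _ X.functionField c)) hb
    simp only [map_mul, map_one] at this
    have hb1 := h1 b
    have ha1 := abv.nonneg (algebraMap _ X.functionField a)
    nlinarith
  let ξ : Xan π :=
    { pt := genericPoint X
      abv := abv.comp (f := (functionFieldEquiv X).symm.toRingHom) (functionFieldEquiv X).symm.injective
      abv_trivial := by
        intro a ha
        -- Triviality on K is automatic: non-zero constants are units of the local ring, where the
        -- absolute value is 1.
        have hu : IsUnit (X.presheaf.germ ⊤ x trivial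
            (π.appTop ((Scheme.ΓSpecIso (CommRingCat.of K)).inv a))) :=
          (((isUnit_iff_ne_zero.2 ha).map (Scheme.ΓSpecIso (CommRingCat.of K)).inv.hom).map
            π.appTop.hom).map (X.presheaf.germ ⊤ x trivial).hom
        rw [residueStructureMap_eq, ← functionFieldEquiv_germ (U := ⊤) (x := x) trivial]
        change abv ((functionFieldEquiv X).symm _) = 1
        rw [RingEquiv.symm_apply_apply]
        exact hunit _ hu }
  have hval : ∀ {U : X.Opens} (hx : x ∈ U) (f : Γ(X, U)),
      ξ.absSection U (genericPoint_mem_of_mem hx) f =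
        abv (algebraMap _ X.functionField (X.presheaf.germ U x hx f)) := by
    intro U hx f
    change abv ((functionFieldEquiv X).symm (X.evaluation U (genericPoint X) _ f)) = _
    rw [← functionFieldEquiv_germ hx, RingEquiv.symm_apply_apply]
  refine ⟨ξ.powSucc, fun n => rfl, tendsto_nhds_generateFrom_iff.2 ?_⟩
  rintro S (⟨U, rfl⟩ | ⟨U, f, A, hA, rfl⟩) hS
  · exact univ_mem' fun n => genericPoint_mem_of_mem hS
  · obtain ⟨hx, hxA⟩ : ∃ hx : x ∈ U, (trivialPoint π x).absSection U hx f ∈ A := hS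
    have hpt : genericPoint X ∈ U := genericPoint_mem_of_mem hx
    have hlim : Tendsto (fun n => (ξ.powSucc n).absSection U hpt f) atTop
        (𝓝 ((trivialPoint π x).absSection U hx f)) := by
      -- Powers of a number < 1 tend to 0 when f vanishes at x; powers of 1 stay at 1 when f is a
      -- unit at x. These limits are the values of |f| at xᵃⁿ.
      have hpow : (fun n => (ξ.powSucc n).absSection U hpt f) = fun n =>
          abv (algebraMap _ X.functionField (X.presheaf.germ U x hx f)) ^ (n + 1) := by
        funext n
        rw [← hval hx]
        rfl
      rw [hpow]
      by_cases h : X.evaluation U x hx f = 0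
      · rw [absSection_trivialPoint_of_eq_zero hx h]
        have hm : X.presheaf.germ U x hx f ∈ IsLocalRing.maximalIdeal (X.presheaf.stalk x) :=
          Ideal.Quotient.eq_zero_iff_mem.1 h
        exact (tendsto_pow_atTop_nhds_zero_of_lt_one (abv.nonneg _) (h2 _ hm)).comp
          (tendsto_add_atTop_nat 1)
      · rw [absSection_trivialPoint_of_ne_zero hx h]
        have hu : IsUnit (X.presheaf.germ U x hx f) := by
          by_contra hu
          exact h (Ideal.Quotient.eq_zero_iff_mem.2 hu)
        simp [hunit _ hu]
    filter_upwards [hlim.eventually (hA.mem_nhds hxA)] with n hn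
    exact ⟨hpt, hn⟩

/-- This density statement forces continuous extensions of a generic germ to agree at xᵃⁿ. If the
local ring at x is a field, the trivial absolute value serves; otherwise a dominating one does. -/
theorem exists_tendsto_trivialPoint [IsLocallyNoetherian X] (x : X) :
    ∃ s : ℕ → Xan π, (∀ n, (s n).pt = genericPoint X) ∧
      Tendsto s atTop (𝓝 (trivialPoint π x)) := by
  classical
  have : IsFractionRing (X.presheaf.stalk x) X.functionField := inferInstance
  by_cases h : IsLocalRing.maximalIdeal (X.presheaf.stalk x) = ⊥
  · refine exists_tendsto_trivialPoint_of_absoluteValue x AbsoluteValue.trivial (fun a => ?_)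
      (fun a ha => ?_)
    · by_cases ha : algebraMap _ X.functionField a = 0
      · simp [ha]
      · exact (AbsoluteValue.trivial_apply ha).le
    · rw [h, Ideal.mem_bot] at ha
      simp [ha]
  · obtain ⟨abv, h1, h2⟩ :=
      IsLocalRing.exists_absoluteValue_dominating (X.presheaf.stalk x) X.functionField h
    exact exists_tendsto_trivialPoint_of_absoluteValue x abv h1 h2

/-- Continuous functions near `xᵃⁿ` with the same generic germ have the same value at `xᵃⁿ`. -/
theorem IsExtension.apply_trivialPoint_eq [IsLocallyNoetherian X]
    {γ : Germ (genericFilter π) ℝ} {U U' : X.Opens} {θ θ' : Xan π → ℝ}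
    (h : IsExtension γ U θ) (h' : IsExtension γ U' θ') {x : X} (hx : x ∈ U) (hx' : x ∈ U') :
    θ (trivialPoint π x) = θ' (trivialPoint π x) := by
  obtain ⟨s, hs, hlim⟩ := exists_tendsto_trivialPoint (π := π) x
  have hc := (h.1.continuousAt ((isOpen_anOpen U).mem_nhds hx)).tendsto.comp hlim
  have hc' := (h'.1.continuousAt ((isOpen_anOpen U').mem_nhds hx')).tendsto.comp hlim
  obtain ⟨V, hV, heq⟩ := Germ.coe_eq.1 (h.2.trans h'.2.symm)
  refine tendsto_nhds_unique hc (hc'.congr fun n => (heq ?_).symm)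
  change (s n).pt ∈ V
  rw [hs n]
  exact genericPoint_mem_iff.2 hV

/-- The map `x ↦ xᵃⁿ` is continuous at the generic point. -/
theorem continuousAt_trivialPoint_genericPoint :
    ContinuousAt (trivialPoint π) (genericPoint X) := by
  refine tendsto_nhds_generateFrom_iff.2 ?_
  rintro S (⟨U, rfl⟩ | ⟨U, f, A, hA, rfl⟩) hS
  · exact U.isOpen.mem_nhds hS
  · obtain ⟨hη, hA'⟩ : ∃ hη : genericPoint X ∈ U,
        (trivialPoint π (genericPoint X)).absSection U hη f ∈ A := hS
    -- On an integral scheme, f either vanishes identically or is invertible on a neighbourhood of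
    -- the generic point, so y ↦ |f|(yᵃⁿ) is locally constant there.
    by_cases h : X.evaluation U (genericPoint X) hη f = 0
    · rw [absSection_trivialPoint_of_eq_zero hη h] at hA'
      filter_upwards [U.isOpen.mem_nhds hη] with y hy
      refine ⟨hy, ?_⟩
      rw [← functionFieldEquiv_germ hy, map_eq_zero_iff _ (functionFieldEquiv X).injective,
        map_eq_zero_iff _ (algebraMap_stalk_injective y)] at h
      have h0 : X.evaluation U y hy f = 0 := by
        change X.residue y (X.presheaf.germ U y hy f) = 0
        rw [h, map_zero]
      rwa [absSection_trivialPoint_of_eq_zero hy h0]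
    · rw [absSection_trivialPoint_of_ne_zero hη h] at hA'
      rw [← ne_eq, Scheme.evaluation_ne_zero_iff_mem_basicOpen] at h
      filter_upwards [(X.basicOpen f).isOpen.mem_nhds h] with y hy
      refine ⟨X.basicOpen_le f hy, ?_⟩
      rwa [absSection_trivialPoint_of_ne_zero (X.basicOpen_le f hy)
        ((Scheme.evaluation_ne_zero_iff_mem_basicOpen _ _ _ _).2 hy)]

end Generic

/-! ### Local equations and heights -/

section LocalEquations

variable {K : Type u} [Field K] {X : Scheme.{u}} [IsIntegral X] {π : X ⟶ Spec (CommRingCat.of K)}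

theorem IsExtension.add {γ γ' : Germ (genericFilter π) ℝ} {U U' : X.Opens} {θ θ' : Xan π → ℝ}
    (h : IsExtension γ U θ) (h' : IsExtension γ' U' θ') :
    IsExtension (γ + γ') (U ⊓ U') (θ + θ') := by
  refine ⟨(h.1.mono fun _ hx => hx.1).add (h'.1.mono fun _ hx => hx.2), ?_⟩
  rw [← h.2, ← h'.2]
  rfl

/-- A unit of a local ring extends to a nowhere vanishing regular function. -/
theorem exists_regular_of_isUnit (x : X) {w : X.presheaf.stalk x} (hw : IsUnit w) :
    ∃ (U : X.Opens) (a : Γ(X, U)), x ∈ U ∧ ∀ (y : X) (hy : y ∈ U), X.evaluation U y hy a ≠ 0 ∧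
      algebraMap _ X.functionField (X.presheaf.germ U y hy a) = algebraMap _ X.functionField w := by
  obtain ⟨U, hU, a, ha⟩ := X.presheaf.exists_germ_eq w
  have hle : X.basicOpen a ≤ U := X.basicOpen_le a
  have hx : x ∈ X.basicOpen a := by
    rw [Scheme.mem_basicOpen _ _ _ hU, ha]
    exact hw
  refine ⟨X.basicOpen a, X.presheaf.map (homOfLE hle).op a, hx, fun y hy => ?_⟩
  have : Nonempty U := ⟨⟨_, hU⟩⟩
  have h1 : X.presheaf.germ (X.basicOpen a) y hy (X.presheaf.map (homOfLE hle).op a) =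
      X.presheaf.germ U y (hle hy) a := X.presheaf.germ_res_apply _ _ _ _
  constructor
  · have h2 : X.evaluation (X.basicOpen a) y hy (X.presheaf.map (homOfLE hle).op a) =
        X.evaluation U y (hle hy) a := congrArg (X.residue y) h1
    rw [h2, Scheme.evaluation_ne_zero_iff_mem_basicOpen]
    exact hy
  · rw [h1, ← ha, Scheme.algebraMap_germ_eq_germToFunctionField,
      Scheme.algebraMap_germ_eq_germToFunctionField]

theorem continuousOn_log_ratAbs {f : X.functionField} {U : X.Opens} {a : Γ(X, U)}
    (ha : ∀ (y : X) (hy : y ∈ U), X.evaluation U y hy a ≠ 0 ∧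
      algebraMap _ X.functionField (X.presheaf.germ U y hy a) = f) :
    ContinuousOn (fun ξ : Xan π => Real.log (ratAbs f ξ)) (anOpen π U) ∧
      ∀ y ∈ U, ratAbs f (trivialPoint π y) = 1 := by
  have key : ∀ (ξ : Xan π) (hξ : ξ.pt ∈ U), ratAbs f ξ = ξ.absSection U hξ a := fun ξ hξ => by
    rw [← (ha ξ.pt hξ).2, ratAbs_algebraMap]
    rfl
  refine ⟨ContinuousOn.log (continuousOn_absSection U a _ key) fun ξ hξ => ?_, fun y hy => ?_⟩
  · rw [key ξ hξ]
    exact ξ.abv.ne_zero (ha ξ.pt hξ).1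
  · rw [key _ hy]
    exact absSection_trivialPoint_of_ne_zero hy (ha y hy).1

/-- If an `ℝ`-rational function is an `ℝ`-unit at `x`, then the logarithm of its absolute value
extends continuously near `x`, and vanishes at the points with trivial absolute value. -/
theorem exists_isExtension_logAbsR_of_ratRGerm_eq_zero {x : X} {φ : RatR X}
    (h : ratRGerm x φ = 0) :
    ∃ (U : X.Opens) (θ : Xan π → ℝ), x ∈ U ∧ IsExtension (logAbsR π φ : Germ (genericFilter π) ℝ) U θ ∧
      ∀ y ∈ U, θ (trivialPoint π y) = 0 := by
  have hexact : Function.Exact (stalkUnits X x).subtype.toIntLinearMap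
      (AddMonoidHom.toIntLinearMap (M₂ := CartierStalk X x) (toCartierStalk X x)) := by
    intro f
    change toCartierStalk X x f = 0 ↔ _
    rw [toCartierStalk, QuotientAddGroup.mk'_apply, QuotientAddGroup.eq_zero_iff]
    exact ⟨fun hf => ⟨⟨f, hf⟩, rfl⟩, by rintro ⟨⟨_, hf⟩, rfl⟩; exact hf⟩
  have hsurj : Function.Surjective
      (AddMonoidHom.toIntLinearMap (M₂ := CartierStalk X x) (toCartierStalk X x)) :=
    QuotientAddGroup.mk'_surjective _
  -- By right exactness of the tensor product, φ is a real combination of units of the local ring at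
  -- x, each of which spreads out to a nowhere vanishing function.
  obtain ⟨ψ, rfl⟩ := (lTensor_exact ℝ hexact hsurj φ).1 h
  clear h
  induction ψ using TensorProduct.induction_on with
  | zero =>
    refine ⟨⊤, 0, trivial, ⟨continuousOn_const, ?_⟩, fun _ _ => rfl⟩
    rw [map_zero, map_zero]
    rfl
  | tmul c f =>
    obtain ⟨f, w, rfl⟩ := f
    obtain ⟨U, a, hx, ha⟩ := exists_regular_of_isUnit x (Additive.toMul w).isUnit
    obtain ⟨h1, h2⟩ := continuousOn_log_ratAbs (π := π) ha
    refine ⟨U, fun ξ => c * Real.log (ratAbs _ ξ), hx, ⟨h1.const_smul c, ?_⟩, fun y hy => ?_⟩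
    · rfl
    · beta_reduce
      rw [h2 y hy, Real.log_one, mul_zero]
  | add ψ₁ ψ₂ ih₁ ih₂ =>
    obtain ⟨U, θ, hx, h, h0⟩ := ih₁
    obtain ⟨U', θ', hx', h', h0'⟩ := ih₂
    refine ⟨U ⊓ U', θ + θ', ⟨hx, hx'⟩, ?_, fun y hy => ?_⟩
    · rw [map_add, map_add]
      exact h.add h'
    · rw [Pi.add_apply, h0 y hy.1, h0' y hy.2, add_zero]

/-- Every non-zero rational function is a unit at the generic point, so the Cartier stalk there is
trivial. -/
theorem ratRGerm_genericPoint (φ : RatR X) : ratRGerm (genericPoint X) φ = 0 := by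
  have hunits : stalkUnits X (genericPoint X) = ⊤ := by
    refine eq_top_iff.2 fun f _ => ?_
    obtain ⟨U, a, hU, ha⟩ := exists_regular f.toMul
    have hη : genericPoint X ∈ U := genericPoint_mem_iff.2 hU
    have hu : IsUnit (X.presheaf.germ U _ hη a) := by
      rw [← Scheme.mem_basicOpen _ _ _ hη, ← Scheme.evaluation_ne_zero_iff_mem_basicOpen _ _ hη]
      exact (ha _ hη).1
    exact ⟨Additive.ofMul hu.unit, Additive.toMul.injective (Units.ext (ha _ hη).2)⟩
  induction φ using TensorProduct.induction_on with
  | zero => exact map_zero _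
  | tmul c f =>
    have h0 : toCartierStalk X (genericPoint X) f = 0 := by
      rw [toCartierStalk, QuotientAddGroup.mk'_apply, QuotientAddGroup.eq_zero_iff, hunits]
      trivial
    change c ⊗ₜ[ℤ] (toCartierStalk X (genericPoint X) f) = 0
    rw [h0, TensorProduct.tmul_zero]
  | add φ₁ φ₂ h₁ h₂ => rw [map_add, h₁, h₂, add_zero]

theorem exists_isLocalEquation (D : RDiv X) (x : X) :
    ∃ (U : X.Opens) (f : RatR X), x ∈ U ∧ IsLocalEquation D U f := by
  induction D using TensorProduct.induction_on with
  | zero => exact ⟨⊤, 0, trivial, fun y _ => by rw [map_zero, map_zero]⟩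
  | tmul c D =>
    obtain ⟨U, hx, f, hf⟩ := D.2 x
    refine ⟨U, c ⊗ₜ[ℤ] f, hx, fun y hy => ?_⟩
    change c ⊗ₜ[ℤ] (D.1 y) = c ⊗ₜ[ℤ] (toCartierStalk X y f)
    rw [hf y hy]
  | add D D' h h' =>
    obtain ⟨U, f, hx, hf⟩ := h
    obtain ⟨U', f', hx', hf'⟩ := h'
    exact ⟨U ⊓ U', f + f', ⟨hx, hx'⟩, fun y hy => by rw [map_add, map_add, hf y hy.1, hf' y hy.2]⟩

/-- The height of a point can be computed with any local equation. -/
theorem height_eq [IsLocallyNoetherian X] (A : AdelicRDiv π) {x : X} {U : X.Opens} {f : RatR X}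
    {θ : Xan π → ℝ} (hx : x ∈ U) (hf : IsLocalEquation A.D U f)
    (hθ : IsExtension ((A.g + logAbsR π f : Chat π) : Germ (genericFilter π) ℝ) U θ) :
    height A x = θ (trivialPoint π x) := by
  have hex : ∃ c, IsHeight A (trivialPoint π x) c :=
    ⟨_, x, U, f, θ, isReductionPoint_pt fun a ha => trivialPoint_abv_apply x ha, hx, hf, hθ, rfl⟩
  rw [height, heightAn, dif_pos hex]
  obtain ⟨r, U', f', θ', hr, hr', hf', hθ', hc⟩ := hex.choose_spec
  rw [hc]
  have hrx : r = x := hr.eq_pt fun a ha => trivialPoint_abv_apply x ha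
  subst hrx
  -- Two local equations differ by an ℝ-unit at the point, whose logarithm extends with value 0 at
  -- trivially valued points. Adding it to the chosen extension gives one with the same generic germ
  -- as θ.
  have h0 : ratRGerm r (f - f') = 0 := by
    rw [map_sub, ← hf r hx, ← hf' r hr', sub_self]
  obtain ⟨V, ρ, hrV, hρ, hρ0⟩ := exists_isExtension_logAbsR_of_ratRGerm_eq_zero (π := π) h0
  have hsum := hθ'.add hρ
  have hγ : ((A.g + logAbsR π f' : Chat π) : Germ (genericFilter π) ℝ) + logAbsR π (f - f') =
      ((A.g + logAbsR π f : Chat π) : Germ (genericFilter π) ℝ) := by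
    rw [← Submodule.coe_add, map_sub]
    congr 1
    abel
  rw [hγ] at hsum
  have := hθ.apply_trivialPoint_eq hsum hx ⟨hr', hrV⟩
  rw [this, Pi.add_apply, hρ0 r hrV, add_zero]

/-! ### Evaluation at η₀ and the essential minimum -/

theorem evalEta0_eq {g : Chat π} {U : X.Opens} {θ : Xan π → ℝ}
    (h : IsExtension (g : Germ (genericFilter π) ℝ) U θ) : evalEta0 g = θ (eta0 π) := by
  rw [evalEta0, ← h.2]
  rfl

theorem evalEta0_add (g g' : Chat π) : evalEta0 (g + g') = evalEta0 g + evalEta0 g' := by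
  obtain ⟨U, θ, -, h⟩ := g.2
  obtain ⟨U', θ', -, h'⟩ := g'.2
  rw [evalEta0_eq h, evalEta0_eq h', evalEta0_eq (g := g + g') (h.add h')]
  rfl

theorem evalEta0_logAbsR (φ : RatR X) : evalEta0 (logAbsR π φ) = 0 := by
  obtain ⟨U, θ, hη, h, h0⟩ :=
    exists_isExtension_logAbsR_of_ratRGerm_eq_zero (π := π) (ratRGerm_genericPoint φ)
  rw [evalEta0_eq h]
  exact h0 _ hη

/-- The heights of the points of `X` tend to `g(η₀)` towards the generic point. -/
theorem tendsto_height [IsLocallyNoetherian X] (A : AdelicRDiv π) :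
    Tendsto (height A) (𝓝 (genericPoint X)) (𝓝 (evalEta0 A.g)) := by
  obtain ⟨U, f, hη, hf⟩ := exists_isLocalEquation A.D (genericPoint X)
  obtain ⟨θ, hθ⟩ := A.isGreen U f ⟨_, hη⟩ hf
  have h1 : evalEta0 A.g = θ (eta0 π) := by
    rw [← evalEta0_eq hθ, evalEta0_add, evalEta0_logAbsR, add_zero]
  rw [h1]
  refine Tendsto.congr' (f₁ := fun x => θ (trivialPoint π x)) ?_ ?_
  · filter_upwards [U.isOpen.mem_nhds hη] with x hx
    exact (height_eq A hx hf hθ).symm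
  · have hc : ContinuousAt θ (trivialPoint π (genericPoint X)) :=
      hθ.1.continuousAt ((isOpen_anOpen U).mem_nhds hη)
    exact hc.tendsto.comp continuousAt_trivialPoint_genericPoint

/-- For c > g(η₀), the heights are < c on a neighbourhood of η, and the Jacobson property puts a
closed point of it outside any given Z. For c < g(η₀), the complement of an open neighbourhood of η
where the heights exceed c is an admissible Z. -/
theorem essMin_eq [IsLocallyNoetherian X] [JacobsonSpace X] (A : AdelicRDiv π) :
    essMin A = (evalEta0 A.g : EReal) := by
  refine le_antisymm (iSup_le fun Z => iSup_le fun hZ => iSup_le fun hne => ?_) ?_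
  · refine EReal.le_of_forall_lt_iff_le.1 fun c hc => ?_
    have hc' : evalEta0 A.g < c := by exact_mod_cast hc
    obtain ⟨V, hV, hVo, hη⟩ := mem_nhds_iff.1 ((tendsto_height A).eventually (gt_mem_nhds hc'))
    have hηZ : genericPoint X ∈ Zᶜ :=
      ((genericPoint_spec X).mem_open_set_iff hZ.isOpen_compl).2
        (by simpa [Set.nonempty_compl] using hne)
    obtain ⟨x, ⟨hxV, hxZ⟩, hx⟩ := nonempty_inter_closedPoints (Z := V ∩ Zᶜ) ⟨_, hη, hηZ⟩
      (hVo.inter hZ.isOpen_compl).isLocallyClosed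
    refine (iInf_le_of_le x (iInf_le_of_le hxZ (iInf_le _ hx))).trans ?_
    exact_mod_cast (hV hxV).le
  · refine EReal.ge_of_forall_gt_iff_ge.1 fun c hc => ?_
    have hc' : c < evalEta0 A.g := by exact_mod_cast hc
    obtain ⟨V, hV, hVo, hη⟩ := mem_nhds_iff.1 ((tendsto_height A).eventually (lt_mem_nhds hc'))
    refine le_iSup_of_le Vᶜ (le_iSup_of_le hVo.isClosed_compl (le_iSup_of_le ?_ ?_))
    · exact fun h => (h ▸ Set.mem_univ (genericPoint X) : genericPoint X ∈ Vᶜ) hη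
    · refine le_iInf fun x => le_iInf fun hx => le_iInf fun _ => ?_
      exact_mod_cast (hV (not_not.1 hx)).le

/-! ### Sup norms and the asymptotic maximal slope -/

theorem evalEta0_logAbs (s : RatUnits X) : evalEta0 (logAbs π s) = 0 := by
  rw [← evalEta0_logAbsR (π := π) ((1 : ℝ) ⊗ₜ[ℤ] s), logAbsR, LinearMap.liftBaseChange_tmul,
    one_smul]
  rfl

theorem evalEta0_neg (g : Chat π) : evalEta0 (-g) = -evalEta0 g := by
  have h0 := evalEta0_add (0 : Chat π) 0
  have h := evalEta0_add (-g) g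
  rw [neg_add_cancel] at h
  rw [add_zero] at h0
  linarith

theorem evalEta0_nsmul (n : ℕ) (g : Chat π) : evalEta0 (n • g) = n * evalEta0 g := by
  induction n with
  | zero =>
    have := evalEta0_add (0 : Chat π) 0
    simp only [add_zero, left_eq_add] at this
    simpa using this
  | succ n ih => rw [succ_nsmul, evalEta0_add, ih]; push_cast; ring

/-- The sup norm dominates the value at η₀, where log|s| = 0. The bound is proved for each candidate
extension θ, so it also covers the case of no extension, where the infimum is ⊤. -/
theorem exp_neg_evalEta0_le_supNorm (g : Chat π) (s : (X.functionField)ˣ) :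
    (Real.exp (-evalEta0 g) : EReal) ≤ supNorm g s := by
  refine le_iInf fun θ => le_iInf fun hθ => ?_
  refine le_iSup_of_le (eta0 π) (EReal.coe_le_coe_iff.2 (le_of_eq ?_))
  have h1 : evalEta0 (-g + logAbs π (Additive.ofMul s)) = -evalEta0 g := by
    rw [evalEta0_add, evalEta0_neg, evalEta0_logAbs, add_zero]
  obtain ⟨U, ρ, -, hρ⟩ := (-g + logAbs π (Additive.ofMul s)).2
  rw [← h1, evalEta0_eq hρ]
  have h2 := hθ.2
  rw [← hρ.2, Germ.map_coe] at h2
  obtain ⟨V, hV, h⟩ := Germ.coe_eq.1 h2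
  exact (h (genericPoint_mem_iff.2 hV : eta0 π ∈ anOpen π V)).symm

theorem lambdaMax_le (D : RDiv X) (g : Chat π) : lambdaMax D g ≤ (evalEta0 g : EReal) := by
  refine iSup_le fun t => iSup_le fun ht => ?_
  -- The norm condition is vacuous at 0, so a filtration step different from {0} contains a non-zero
  -- section.
  have h0 : (0 : X.functionField) ∈ filtH0 D g t :=
    ⟨Or.inr rfl, fun u hu => absurd hu u.ne_zero⟩
  obtain ⟨s, hs, hs0⟩ : ∃ s ∈ filtH0 D g t, s ≠ 0 := by
    by_contra! hcon
    exact ht (Set.eq_singleton_iff_unique_mem.2 ⟨h0, hcon⟩)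
  have h := (exp_neg_evalEta0_le_supNorm g (Units.mk0 s hs0)).trans (hs.2 _ rfl)
  rw [EReal.coe_le_coe_iff, Real.exp_le_exp, neg_le_neg_iff] at h
  exact_mod_cast h

theorem lambdaMaxAsy_le (A : AdelicRDiv π) : lambdaMaxAsy A ≤ (evalEta0 A.g : EReal) := by
  refine limsup_le_of_le (by isBoundedDefault) ?_
  -- For n > 0 division by n can be undone, and the bound follows from (ng)(η₀) = n g(η₀).
  filter_upwards [eventually_gt_atTop 0] with n hn
  rw [EReal.div_le_iff_le_mul (by exact_mod_cast hn) (EReal.natCast_ne_top n)]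
  refine (lambdaMax_le _ _).trans (le_of_eq ?_)
  rw [evalEta0_nsmul, EReal.coe_mul]
  rfl

end LocalEquations

end TrivVal

theorem mainTheorem9 {K : Type u} [Field K] {X : Scheme.{u}} [IsIntegral X]
    (π : X ⟶ Spec (CommRingCat.of K)) (hπ : TrivVal.IsProjectiveOver π)
    (A : TrivVal.AdelicRDiv π) :
    TrivVal.essMin A = (TrivVal.evalEta0 A.g : EReal) ∧
      TrivVal.lambdaMaxAsy A ≤ TrivVal.essMin A ∧
      TrivVal.essMin A < ⊤ ∧ TrivVal.lambdaMaxAsy A < ⊤ := by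
  have := hπ.locallyOfFiniteType
  have : IsLocallyNoetherian X := LocallyOfFiniteType.isLocallyNoetherian π
  have : JacobsonSpace X := LocallyOfFiniteType.jacobsonSpace π
  have h1 := TrivVal.essMin_eq A
  have h2 := TrivVal.lambdaMaxAsy_le A
  have h3 : (TrivVal.evalEta0 A.g : EReal) < ⊤ := EReal.coe_lt_top _
  rw [h1]
  exact ⟨rfl, h2, h3, h2.trans_lt h3⟩
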